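/- Let $n \ge 1$ and $t \ge 0$ be integers with $n \ge 2t+110$. Identify a graph on the vertex set $[n]=\{1,\dots,n\}$ with its set of edges, so that $|G|$ is the number of edges of $G$. A star on $[n]$ is a tree on $[n]$ in which one vertex is adjacent to all the others. Let $F$ be a forest on $[n]$ with exactly $t$ edges, and let $T_0$ be a spanning tree of the complete graph $K_n$ that is not a star and satisfies $|T_0 \cap F| < t$. Then $$\bigl|\{\,T : T \text{ is a spanning tree of } K_n,\ F \subseteq T,\ (T\cap T_0)\setminus F=\emptyset \,\}\bigr| \;>\; n^{\,n-2t-17}.$$ -/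

import Mathlib

/-- Spanning trees of `K_n`, as graphs on the labelled vertex set `Fin n`. -/
def spanningTrees (n : ℕ) : Set (SimpleGraph (Fin n)) :=
  {T | T.IsTree}

/-- The stars of `K_n`: some vertex `c` is joined to all other vertices, and there are no further
edges. -/
def stars (n : ℕ) : Set (SimpleGraph (Fin n)) :=
  {T | ∃ c : Fin n, T = SimpleGraph.starGraph c}

/-- The spanning trees `T` of `K_n` that contain `F` and satisfy `(T ∩ T₀) \ F = ∅`
(as edge sets). -/
def treesAvoidingOutside {n : ℕ} (T₀ F : SimpleGraph (Fin n)) : Set (SimpleGraph (Fin n)) :=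
  {T | T ∈ spanningTrees n ∧ F.edgeSet ⊆ T.edgeSet ∧
    (T.edgeSet ∩ T₀.edgeSet) \ F.edgeSet = ∅}

open Finset

/-! Orient `F` as a parent map, then hang one root at a time below a vertex of another tree, never
along an edge of `T₀`, until one root is left. With k + 1 roots there are nk moves, and those
forbidden by `T₀` number at most the degree sum of the roots, which is at most 2n. Each completion
is reached through at most k first moves. Induction gives about n^(k-2) (k-2)!/k! completions
(`pow_mul_factorial_le_card_completions`), and a tree arises from at most n of them, one per root
(`card_completions_le`). For k ≤ 2 the bound n(k-2) is void, yet a move must exist. This is secured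
by making a vertex `v` of maximal `T₀`-degree a non-root at the start, possible because `T₀` is not
a star (`exists_initial_forest`). -/

section RootedForest

/-! ### Rooted forests as parent maps -/

variable {V : Type*}

/-- A parent map whose fixed points are the roots: along every other vertex some rank drops. -/
def IsRootedForest (p : V → V) : Prop :=
  ∃ h : V → ℕ, ∀ x, p x ≠ x → h (p x) < h x

/-- The graph joining each vertex to its parent. -/
def parentGraph (p : V → V) : SimpleGraph V :=
  SimpleGraph.fromRel fun x y => p x = y

lemma parentGraph_adj {p : V → V} {x y : V} :
    (parentGraph p).Adj x y ↔ x ≠ y ∧ (p x = y ∨ p y = x) := Iff.rfl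

lemma parentGraph_reachable_iterate (p : V → V) (x : V) (k : ℕ) :
    (parentGraph p).Reachable x (p^[k] x) := by
  induction k with
  | zero => exact SimpleGraph.Reachable.rfl
  | succ k ih =>
    rw [Function.iterate_succ_apply']
    by_cases h : p^[k] x = p (p^[k] x)
    · rwa [← h]
    · exact ih.trans (SimpleGraph.Adj.reachable (parentGraph_adj.2 ⟨h, Or.inl rfl⟩))

lemma IsRootedForest.exists_rootMap [Fintype V] {p : V → V} (hp : IsRootedForest p) :
    ∃ c : V → V, (∀ x, p (c x) = c x) ∧ (∀ x, c (p x) = c x) ∧ (∀ x, p x = x → c x = x) ∧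
      ∀ x, (parentGraph p).Reachable x (c x) := by
  obtain ⟨h, hh⟩ := hp
  have key : ∀ k x, h x ≤ k → p (p^[k] x) = p^[k] x := by
    intro k
    induction k with
    | zero =>
      intro x hx
      by_contra hne
      have := hh x hne
      omega
    | succ k ih =>
      intro x hx
      by_cases hpx : p x = x
      · rw [Function.iterate_fixed hpx, hpx]
      · rw [Function.iterate_succ_apply]
        exact ih _ (by have := hh x hpx; omega)
  -- The sum of all ranks bounds each one, so a single iterate of `p` sends every vertex to its
  -- root.
  have hle : ∀ x, h x ≤ ∑ y, h y := fun x =>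
    single_le_sum (f := h) (fun _ _ => Nat.zero_le _) (mem_univ x)
  refine ⟨p^[∑ y, h y], fun x => key _ x (hle x), fun x => ?_, fun x hx =>
    Function.iterate_fixed hx _, fun x => parentGraph_reachable_iterate p x _⟩
  rw [← Function.iterate_succ_apply, Function.iterate_succ_apply', key _ x (hle x)]

lemma IsRootedForest.update [DecidableEq V] {p c : V → V} {r u : V} (hp : IsRootedForest p)
    (hc : ∀ x, c (p x) = c x) (hr : c r = r) (hu : c u ≠ r) :
    IsRootedForest (Function.update p r u) := by
  obtain ⟨h, hh⟩ := hp
  -- The whole tree of `r` is lifted above `u`.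
  refine ⟨fun x => h x + if c x = r then h u + 1 else 0, fun x hx => ?_⟩
  by_cases hxr : x = r
  · subst hxr
    simp only [Function.update_self, hu, hr, if_true, if_false]
    omega
  · rw [Function.update_of_ne hxr] at hx ⊢
    simpa [hc] using hh x hx

variable [Fintype V] [DecidableEq V]

/-- The roots of a parent map. -/
def roots (p : V → V) : Finset V := univ.filter fun x => p x = x

@[simp] lemma mem_roots {p : V → V} {x : V} : x ∈ roots p ↔ p x = x := by simp [roots]

lemma roots_update {p : V → V} {r u : V} (hu : u ≠ r) :
    roots (Function.update p r u) = (roots p).erase r := by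
  ext x
  by_cases hx : x = r
  · subst hx; simp [hu]
  · simp [hx]

/-! ### Double counting of completions -/

open Classical in
/-- The single-rooted forests that extend `p` by edges outside `T`. -/
noncomputable def completions (T : SimpleGraph V) (p : V → V) : Finset (V → V) :=
  univ.filter fun g => IsRootedForest g ∧ #(roots g) = 1 ∧ (∀ x, p x ≠ x → g x = p x) ∧
    ∀ x, p x = x → g x ≠ x → ¬ T.Adj x (g x)

lemma mem_completions {T : SimpleGraph V} {p g : V → V} :
    g ∈ completions T p ↔ IsRootedForest g ∧ #(roots g) = 1 ∧ (∀ x, p x ≠ x → g x = p x) ∧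
      ∀ x, p x = x → g x ≠ x → ¬ T.Adj x (g x) := by
  simp [completions]

/-- The pairs `(r, u)` for which the root `r` may be hung below `u`, where `c` maps each vertex to
its root. -/
def extensionPairs (T : SimpleGraph V) [DecidableRel T.Adj] (p c : V → V) : Finset (V × V) :=
  univ.filter fun e => p e.1 = e.1 ∧ c e.2 ≠ e.1 ∧ ¬ T.Adj e.1 e.2

lemma completions_update_subset {T : SimpleGraph V} {p g : V → V} {r u : V}
    (hr : p r = r) (hu : u ≠ r) (hT : ¬ T.Adj r u)
    (hg : g ∈ completions T (Function.update p r u)) : g ∈ completions T p ∧ g r = u := by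
  rw [mem_completions] at hg ⊢
  obtain ⟨h1, h2, h3, h4⟩ := hg
  have hgr : g r = u := by simpa using h3 r (by simpa using hu)
  refine ⟨⟨h1, h2, fun x hx => ?_, fun x hx hgx => ?_⟩, hgr⟩
  · have hxr : x ≠ r := by rintro rfl; exact hx hr
    simpa [hxr] using h3 x (by simpa [hxr] using hx)
  · by_cases hxr : x = r
    · subst hxr; rwa [hgr]
    · exact h4 x (by simpa [hxr] using hx) hgx

/-- A completion `g` hangs all roots of `p` but one, and a pair `(r, u)` leading to `g` is
determined by `r`, since `u = g r`. -/
lemma sum_card_completions_update_le (T : SimpleGraph V) [DecidableRel T.Adj] {p c : V → V}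
    (hc : ∀ x, p x = x → c x = x) :
    ∑ e ∈ extensionPairs T p c, #(completions T (Function.update p e.1 e.2)) ≤
      #(completions T p) * (#(roots p) - 1) := by
  have hfib : ∀ g ∈ completions T p, #((roots p).filter fun r => g r ≠ r) = #(roots p) - 1 := by
    intro g hg
    obtain ⟨-, h2, h3, -⟩ := mem_completions.1 hg
    have hsub : roots g ⊆ roots p := by
      intro x hx
      rw [mem_roots] at hx ⊢
      by_contra hne
      exact hne ((h3 x hne).symm.trans hx)
    have : ((roots p).filter fun r => g r ≠ r) = roots p \ roots g := by
      ext x; simp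
    rw [this, card_sdiff_of_subset hsub, h2]
  rw [← card_sigma, ← smul_eq_mul, ← sum_const, ← sum_congr rfl hfib, ← card_sigma]
  have hmem : ∀ s ∈ (extensionPairs T p c).sigma fun e =>
      completions T (Function.update p e.1 e.2),
      (p s.1.1 = s.1.1 ∧ s.1.2 ≠ s.1.1) ∧ s.2 ∈ completions T p ∧ s.2 s.1.1 = s.1.2 := by
    rintro ⟨⟨r, u⟩, g⟩ hs
    simp only [extensionPairs, mem_sigma, mem_filter, mem_univ, true_and] at hs ⊢
    obtain ⟨⟨hr, hcu, hT⟩, hg⟩ := hs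
    have hu : u ≠ r := by rintro rfl; exact hcu (hc _ hr)
    exact ⟨⟨hr, hu⟩, completions_update_subset hr hu hT hg⟩
  refine card_le_card_of_injOn (fun s => ⟨s.2, s.1.1⟩) ?_ ?_
  · intro s hs
    obtain ⟨⟨hr, hu⟩, hg, hgr⟩ := hmem s hs
    simp only [coe_sigma, Set.mem_sigma_iff, mem_coe, mem_filter, mem_roots]
    exact ⟨hg, hr, by rwa [hgr]⟩
  · intro s hs s' hs' heq
    obtain ⟨-, -, hgr⟩ := hmem s hs
    obtain ⟨-, -, hgr'⟩ := hmem s' hs'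
    obtain ⟨⟨r, u⟩, g⟩ := s
    obtain ⟨⟨r', u'⟩, g'⟩ := s'
    simp only [Sigma.mk.injEq, heq_eq_eq] at heq hgr hgr'
    obtain ⟨rfl, rfl⟩ := heq
    rw [← hgr, ← hgr']

lemma card_mul_le_card_extensionPairs_add (T : SimpleGraph V) [DecidableRel T.Adj] {p c : V → V}
    (hc : ∀ x, p (c x) = c x) :
    Fintype.card V * (#(roots p) - 1) ≤
      #(extensionPairs T p c) + ∑ r ∈ roots p, T.degree r := by
  have h1 : #((univ : Finset V).sigma fun u => (roots p).erase (c u)) =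
      Fintype.card V * (#(roots p) - 1) := by
    rw [card_sigma, sum_congr rfl fun u _ => card_erase_of_mem (mem_roots.2 (hc u))]
    simp
  have h2 : #((roots p).sigma fun r => T.neighborFinset r) = ∑ r ∈ roots p, T.degree r := by
    simp [card_sigma]
  rw [← h1, ← h2, ← card_disjSum]
  refine card_le_card_of_injOn
    (fun s => if T.Adj s.2 s.1 then Sum.inr ⟨s.2, s.1⟩ else Sum.inl (s.2, s.1)) ?_ ?_
  · rintro ⟨u, r⟩ hs
    simp only [coe_sigma, Set.mem_sigma_iff, mem_coe, mem_erase, mem_roots] at hs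
    by_cases hT : T.Adj r u
    · simp [hT, hs.2.2]
    · simp [hT, extensionPairs, hs.2.2, hs.2.1.symm]
  · rintro ⟨u, r⟩ - ⟨u', r'⟩ - heq
    by_cases hT : T.Adj r u <;> by_cases hT' : T.Adj r' u' <;> simp [hT, hT'] at heq <;>
      simp [heq]

-- Each step gains a factor n(k-2) from the pairs and loses a factor k. Truncation of `k - 2` makes
-- the gain 1 in the last two steps, where one available pair suffices.
open Nat in
lemma pow_mul_factorial_le_card_completions (T : SimpleGraph V) [DecidableRel T.Adj] (v : V)
    (hv : 1 ≤ T.degree v) (hsum : ∑ x, T.degree x ≤ 2 * Fintype.card V)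
    (hpair : ∀ a b, a ≠ b → a ≠ v → b ≠ v → T.degree a + T.degree b < Fintype.card V) (k : ℕ) :
    ∀ p : V → V, IsRootedForest p → p v ≠ v → #(roots p) = k + 1 →
      Fintype.card V ^ (k - 2) * (k - 2)! ≤ k ! * #(completions T p) := by
  induction k with
  | zero =>
    intro p hp _ hk
    have : p ∈ completions T p := mem_completions.2 ⟨hp, hk, fun _ _ => rfl, fun x h1 h2 =>
      absurd h1 h2⟩
    simpa using card_pos.2 ⟨p, this⟩
  | succ k ih =>
    intro p hp hpv hk
    obtain ⟨c, hc1, hc2, hc3, -⟩ := hp.exists_rootMap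
    have hrec := sum_card_completions_update_le T hc3
    have hcount := card_mul_le_card_extensionPairs_add T hc1
    rw [hk] at hrec hcount
    simp only [Nat.add_sub_cancel] at hrec hcount
    have hvr : v ∉ roots p := by simpa using hpv
    have hrs : ∑ r ∈ roots p, T.degree r + T.degree v ≤ 2 * Fintype.card V := by
      rw [add_comm, ← sum_insert (f := fun x => T.degree x) hvr]
      exact (sum_le_sum_of_subset (subset_univ _)).trans hsum
    have hN : Fintype.card V ^ (k + 1 - 2) * (k + 1 - 2)! ≤
        #(extensionPairs T p c) * (Fintype.card V ^ (k - 2) * (k - 2)!) := by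
      match k, hk, hcount with
      | 0, hk, hcount =>
        obtain ⟨a, b, hab, hR⟩ := card_eq_two.1 hk
        rw [hR, sum_pair hab] at hcount
        rw [hR] at hvr
        simp only [mem_insert, mem_singleton, not_or] at hvr
        have := hpair a b hab (Ne.symm hvr.1) (Ne.symm hvr.2)
        have hpos : 0 < #(extensionPairs T p c) := by omega
        simpa using hpos
      -- Three roots: their degrees sum to less than 2n because `v`, of positive degree, is not
      -- among them.
      | 1, hk, hcount =>
        have hpos : 0 < #(extensionPairs T p c) := by omega
        simpa using hpos
      | j + 2, hk, hcount =>
        have h1 : Fintype.card V * (j + 1) ≤ #(extensionPairs T p c) := by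
          have : Fintype.card V * (j + 2 + 1) = Fintype.card V * (j + 1) + 2 * Fintype.card V := by
            ring
          omega
        calc Fintype.card V ^ (j + 2 + 1 - 2) * (j + 2 + 1 - 2)!
            = Fintype.card V * (j + 1) * (Fintype.card V ^ j * j !) := by
              rw [show j + 2 + 1 - 2 = j + 1 by omega, Nat.factorial_succ]; ring
          _ ≤ _ := Nat.mul_le_mul_right _ h1
    have hstep : ∀ e ∈ extensionPairs T p c, Fintype.card V ^ (k - 2) * (k - 2)! ≤
        k ! * #(completions T (Function.update p e.1 e.2)) := by
      rintro ⟨r, u⟩ he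
      simp only [extensionPairs, mem_filter, mem_univ, true_and] at he ⊢
      obtain ⟨hr, hu, -⟩ := he
      have hur : u ≠ r := by rintro rfl; exact hu (hc3 _ hr)
      have hvr' : v ≠ r := by rintro rfl; exact hpv hr
      refine ih _ (hp.update hc2 (hc3 r hr) hu) (by simpa [hvr'] using hpv) ?_
      rw [roots_update hur, card_erase_of_mem (mem_roots.2 hr), hk]
      rfl
    calc Fintype.card V ^ (k + 1 - 2) * (k + 1 - 2)!
        ≤ #(extensionPairs T p c) * (Fintype.card V ^ (k - 2) * (k - 2)!) := hN
      _ ≤ ∑ e ∈ extensionPairs T p c, k ! * #(completions T (Function.update p e.1 e.2)) := by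
          rw [← smul_eq_mul]
          exact card_nsmul_le_sum _ _ _ hstep
      _ = k ! * ∑ e ∈ extensionPairs T p c, #(completions T (Function.update p e.1 e.2)) := by
          rw [mul_sum]
      _ ≤ k ! * (#(completions T p) * (k + 1)) := Nat.mul_le_mul_left _ hrec
      _ = (k + 1)! * #(completions T p) := by rw [Nat.factorial_succ]; ring

/-! ### From parent maps to trees -/

lemma IsRootedForest.parentGraph_isTree {g : V → V} (hg : IsRootedForest g)
    (h1 : #(roots g) = 1) : (parentGraph g).IsTree := by
  classical
  obtain ⟨c, hc1, -, -, hc4⟩ := hg.exists_rootMap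
  obtain ⟨r, hr⟩ := card_eq_one.1 h1
  have hcr : ∀ x, c x = r := fun x => by
    have : c x ∈ roots g := mem_roots.2 (hc1 x)
    simpa [hr] using this
  have hconn : (parentGraph g).Connected := by
    have : Nonempty V := ⟨r⟩
    refine SimpleGraph.Connected.mk fun x y => ?_
    have hx := hc4 x
    have hy := hc4 y
    rw [hcr] at hx hy
    exact hx.trans hy.symm
  refine SimpleGraph.isTree_iff_connected_and_card.2 ⟨hconn, le_antisymm ?_
    hconn.card_vert_le_card_edgeSet_add_one⟩
  have hsub : (parentGraph g).edgeSet ⊆ ↑((univ.erase r).image fun x => s(x, g x)) := by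
    intro e
    induction e with
    | h x y =>
      intro he
      obtain ⟨hne, h | h⟩ := parentGraph_adj.1 ((SimpleGraph.mem_edgeSet _).1 he)
      all_goals
        simp only [coe_image, Set.mem_image, mem_coe, mem_erase, mem_univ, and_true]
      · refine ⟨x, ?_, by rw [h]⟩
        rintro rfl
        exact hne ((mem_roots.1 (hr ▸ mem_singleton_self x)).symm.trans h)
      · refine ⟨y, ?_, by rw [h, Sym2.eq_swap]⟩
        rintro rfl
        exact hne (h.symm.trans (mem_roots.1 (hr ▸ mem_singleton_self y)))
  have hcard : Nat.card (parentGraph g).edgeSet ≤ Fintype.card V - 1 := by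
    rw [Nat.card_coe_set_eq]
    calc _ ≤ _ := Set.ncard_le_ncard hsub (finite_toSet _)
      _ ≤ _ := by
        rw [Set.ncard_coe_finset]
        exact card_image_le.trans (by simp)
  have : 0 < Fintype.card V := Fintype.card_pos_iff.2 ⟨r⟩
  rw [Nat.card_eq_fintype_card (α := V)]
  omega

/-- Induction on rank: if `g'` reversed the edge from `x` to `g x`, then `g` would too by induction,
and the rank would drop both ways. -/
lemma IsRootedForest.eq_of_parentGraph_eq {g g' : V → V} (hg : IsRootedForest g) {r : V}
    (hr : roots g = {r}) (hr' : g' r = r) (h : parentGraph g = parentGraph g') : g = g' := by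
  obtain ⟨f, hf⟩ := hg
  have hroot : ∀ x, g x = x ↔ x = r := fun x => by rw [← mem_roots, hr, mem_singleton]
  suffices H : ∀ k x, f x = k → g' x = g x from funext fun x => (H _ x rfl).symm
  intro k
  induction k using Nat.strong_induction_on with
  | _ k ih =>
    intro x hx
    by_cases hxr : x = r
    · rw [hxr, hr', (hroot r).2 rfl]
    · have hgx : g x ≠ x := fun h => hxr ((hroot x).1 h)
      have hadj : (parentGraph g').Adj x (g x) :=
        h ▸ parentGraph_adj.2 ⟨hgx.symm, Or.inl rfl⟩
      obtain ⟨-, h1 | h1⟩ := parentGraph_adj.1 hadj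
      · exact h1
      · exfalso
        have hlt := hf x hgx
        rw [ih _ (hx ▸ hlt) _ rfl] at h1
        have := hf (g x) (by rw [h1]; exact hgx.symm)
        rw [h1] at this
        omega

/-! ### Orienting an acyclic graph -/

lemma card_nonroots_le {F : SimpleGraph V} {p : V → V} (hp : IsRootedForest p)
    (hF : ∀ x, p x ≠ x → F.Adj x (p x)) : Fintype.card V ≤ #(roots p) + F.edgeSet.ncard := by
  obtain ⟨h, hh⟩ := hp
  have h1 : #(roots p)ᶜ ≤ F.edgeSet.ncard := by
    rw [← Set.ncard_coe_finset]
    refine Set.ncard_le_ncard_of_injOn (fun x => s(x, p x)) (fun x hx => ?_) ?_ (Set.toFinite _)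
    · exact hF x (by simpa using hx)
    · intro x hx y hy hxy
      have hx' := hh x (by simpa using hx)
      have hy' := hh y (by simpa using hy)
      rcases Sym2.eq_iff.1 hxy with h | ⟨h1, h2⟩
      · exact h.1
      · rw [h2] at hx'
        rw [← h1] at hy'
        omega
  have := card_add_card_compl (roots p)
  omega

omit [DecidableEq V] in
lemma SimpleGraph.IsAcyclic.exists_isRootedForest {F : SimpleGraph V} (hF : F.IsAcyclic) (v : V) :
    ∃ p : V → V, IsRootedForest p ∧ (∀ x, p x ≠ x → F.Adj x (p x)) ∧
      (∀ x y, F.Adj x y → p x = y ∨ p y = x) ∧ ∀ w, F.Adj v w → p v ≠ v := by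
  -- The root of a component avoids `v` unless `v` is isolated.
  have hrep : ∀ C : F.ConnectedComponent, ∃ r, F.connectedComponentMk r = C ∧
      ((∃ w, w ≠ v ∧ F.connectedComponentMk w = C) → r ≠ v) := by
    intro C
    by_cases hC : ∃ w, w ≠ v ∧ F.connectedComponentMk w = C
    · obtain ⟨w, hw, hwC⟩ := hC
      exact ⟨w, hwC, fun _ => hw⟩
    · obtain ⟨r, hr⟩ := C.exists_rep
      exact ⟨r, hr, fun h => absurd h hC⟩
  choose rep hrep1 hrep2 using hrep
  set ρ : V → V := fun x => rep (F.connectedComponentMk x) with hρ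
  have hreach : ∀ x, F.Reachable x (ρ x) := fun x =>
    (SimpleGraph.ConnectedComponent.exact (hrep1 (F.connectedComponentMk x))).symm
  have hρeq : ∀ x y, F.Reachable x y → ρ x = ρ y := fun x y hxy => by
    simp only [hρ, SimpleGraph.ConnectedComponent.sound hxy]
  have hnext : ∀ x, ∃ y, (x = ρ x ∧ y = x) ∨
      (x ≠ ρ x ∧ F.Adj x y ∧ F.dist y (ρ x) < F.dist x (ρ x)) := by
    intro x
    by_cases hx : x = ρ x
    · exact ⟨x, Or.inl ⟨hx, rfl⟩⟩
    · obtain ⟨w, hw⟩ := (hreach x).exists_walk_length_eq_dist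
      generalize ρ x = r at *
      cases w with
      | nil => exact absurd rfl hx
      | cons hadj w' =>
        rw [SimpleGraph.Walk.length_cons] at hw
        have := SimpleGraph.dist_le w'
        exact ⟨_, Or.inr ⟨hx, hadj, by omega⟩⟩
  choose p hp using hnext
  have hadj : ∀ x, p x ≠ x → F.Adj x (p x) := fun x hx => by
    rcases hp x with h | h
    · exact absurd h.2 hx
    · exact h.2.1
  have hroot : ∀ x, p x = x → x = ρ x := fun x hx => by
    rcases hp x with h | h
    · exact h.1
    · rw [hx] at h
      exact absurd h.2.1 (F.irrefl)
  have hforest : IsRootedForest p := by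
    refine ⟨fun x => F.dist x (ρ x), fun x hx => ?_⟩
    rcases hp x with h | h
    · exact absurd h.2 hx
    · show F.dist (p x) (ρ (p x)) < F.dist x (ρ x)
      rw [← hρeq _ _ h.2.1.reachable]
      exact h.2.2
  refine ⟨p, hforest, hadj, fun x y hxy => ?_, fun w hw hv => ?_⟩
  -- If the edge were unused, the parent graph would join `x` and `y` through their common root
  -- without it, but it is a bridge.
  · by_contra hcon
    obtain ⟨c, hc1, -, -, hc4⟩ := hforest.exists_rootMap
    have hle : parentGraph p ≤ F.deleteEdges {s(x, y)} := by
      intro a b hab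
      rw [SimpleGraph.deleteEdges_adj]
      obtain ⟨hne, h | h⟩ := parentGraph_adj.1 hab
      · subst h
        refine ⟨hadj a hne.symm, fun hmem => hcon ?_⟩
        rcases Sym2.eq_iff.1 hmem with ⟨rfl, h⟩ | ⟨rfl, h⟩
        · exact Or.inl h
        · exact Or.inr h
      · subst h
        refine ⟨(hadj b hne).symm, fun hmem => hcon ?_⟩
        rcases Sym2.eq_iff.1 hmem with ⟨h, rfl⟩ | ⟨h, rfl⟩
        · exact Or.inr h
        · exact Or.inl h
    have hcρ : ∀ z, c z = ρ z := fun z => by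
      rw [hroot _ (hc1 z)]
      exact (hρeq _ _ ((hc4 z).mono (hle.trans (SimpleGraph.deleteEdges_le _)))).symm
    have hcxy : c x = c y := by rw [hcρ, hcρ, hρeq _ _ hxy.reachable]
    have hr : (parentGraph p).Reachable x y := (hc4 x).trans (hcxy ▸ (hc4 y).symm)
    exact SimpleGraph.isBridge_iff.1
      (SimpleGraph.isAcyclic_iff_forall_isBridge.1 hF ((SimpleGraph.mem_edgeSet _).2 hxy))
      (hr.mono hle)
  · exact hrep2 _ ⟨w, hw.ne', (SimpleGraph.ConnectedComponent.sound hw.reachable).symm⟩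
      (hroot v hv).symm

/-! ### Degrees in acyclic graphs -/

lemma SimpleGraph.IsAcyclic.card_inter_neighborFinset_le_one {T : SimpleGraph V}
    [DecidableRel T.Adj] (hT : T.IsAcyclic) {a b : V} (hab : a ≠ b) :
    #(T.neighborFinset a ∩ T.neighborFinset b) ≤ 1 := by
  rw [card_le_one]
  intro x hx y hy
  simp only [mem_inter, SimpleGraph.mem_neighborFinset] at hx hy
  have hpath : ∀ z, (h1 : T.Adj a z) → (h2 : T.Adj b z) →
      (SimpleGraph.Walk.cons h1 (SimpleGraph.Walk.cons h2.symm SimpleGraph.Walk.nil)).IsPath := by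
    intro z h1 h2
    simp [SimpleGraph.Walk.cons_isPath_iff, h1.ne, h2.ne', hab]
  have := (hT.subsingleton_path a b).elim ⟨_, hpath x hx.1 hx.2⟩ ⟨_, hpath y hy.1 hy.2⟩
  simp only [Subtype.mk.injEq, SimpleGraph.Walk.cons.injEq] at this
  exact this.1

/-- Three neighbourhoods in `V` with pairwise overlaps of at most one vertex. -/
lemma SimpleGraph.IsAcyclic.degree_add_degree_add_degree_le {T : SimpleGraph V}
    [DecidableRel T.Adj] (hT : T.IsAcyclic) {a b c : V} (hab : a ≠ b) (hac : a ≠ c)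
    (hbc : b ≠ c) : T.degree a + T.degree b + T.degree c ≤ Fintype.card V + 3 := by
  have h1 := card_union_add_card_inter (T.neighborFinset a) (T.neighborFinset b)
  have h2 := card_union_add_card_inter (T.neighborFinset a ∪ T.neighborFinset b)
    (T.neighborFinset c)
  have h3 := hT.card_inter_neighborFinset_le_one hab
  have h4 := hT.card_inter_neighborFinset_le_one hac
  have h5 := hT.card_inter_neighborFinset_le_one hbc
  rw [union_inter_distrib_right] at h2
  have h6 := card_union_le (T.neighborFinset a ∩ T.neighborFinset c)
    (T.neighborFinset b ∩ T.neighborFinset c)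
  have h7 := card_le_univ (T.neighborFinset a ∪ T.neighborFinset b ∪ T.neighborFinset c)
  simp only [SimpleGraph.card_neighborFinset_eq_degree] at h1 h2
  omega

end RootedForest

/-! ### The initial forest and the final estimate -/

lemma exists_not_adj_of_notMem_stars {n : ℕ} {T : SimpleGraph (Fin n)} (hT : T.IsTree)
    (hs : T ∉ stars n) (v : Fin n) : ∃ u, u ≠ v ∧ ¬ T.Adj v u := by
  by_contra! hcon
  refine hs ⟨v, le_antisymm (fun x y hxy => ?_) fun x y hxy => ?_⟩
  · rw [SimpleGraph.starGraph_adj]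
    refine ⟨hxy.ne, ?_⟩
    -- In a tree, adjacent vertices have different distances from `v`.
    by_contra! h
    refine hT.dist_ne_of_adj v hxy ?_
    rw [SimpleGraph.dist_eq_one_iff_adj.2 (hcon x h.1),
      SimpleGraph.dist_eq_one_iff_adj.2 (hcon y h.2)]
  · rw [SimpleGraph.starGraph_adj] at hxy
    obtain ⟨hne, rfl | rfl⟩ := hxy
    · exact hcon y hne.symm
    · exact (hcon x hne).symm

lemma card_completions_le {n : ℕ} {T₀ F : SimpleGraph (Fin n)} {p : Fin n → Fin n}
    (hF : ∀ x y, F.Adj x y → x ≠ y ∧ (p x = y ∨ p y = x))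
    (hT₀ : ∀ x, p x ≠ x → F.Adj x (p x) ∨ ¬ T₀.Adj x (p x)) :
    #(completions T₀ p) ≤ (treesAvoidingOutside T₀ F).ncard * n := by
  rcases isEmpty_or_nonempty (Fin n) with hempty | hnonempty
  · have : completions T₀ p = ∅ := eq_empty_of_forall_notMem fun g hg => by
      obtain ⟨r, -⟩ := card_eq_one.1 (mem_completions.1 hg).2.1
      exact hempty.elim r
    simp [this]
  have hroot : ∀ g ∈ completions T₀ p, ∃ r, roots g = {r} := fun g hg =>
    card_eq_one.1 (mem_completions.1 hg).2.1
  choose! r hr using hroot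
  have hprod : (treesAvoidingOutside T₀ F).ncard * n =
      (treesAvoidingOutside T₀ F ×ˢ (Set.univ : Set (Fin n))).ncard := by
    rw [Set.ncard_prod, Set.ncard_univ, Nat.card_eq_fintype_card, Fintype.card_fin]
  rw [hprod, ← Set.ncard_coe_finset]
  refine Set.ncard_le_ncard_of_injOn (fun g => (parentGraph g, r g)) (fun g hg => ?_) ?_
    (Set.toFinite _)
  · obtain ⟨h1, h2, h3, h4⟩ := mem_completions.1 (mem_coe.1 hg)
    refine ⟨⟨h1.parentGraph_isTree h2, ?_, ?_⟩, Set.mem_univ _⟩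
    · refine SimpleGraph.edgeSet_mono fun x y hxy => parentGraph_adj.2 ?_
      obtain ⟨hne, h | h⟩ := hF x y hxy
      · exact ⟨hne, Or.inl ((h3 x (h ▸ hne.symm)).trans h)⟩
      · exact ⟨hne, Or.inr ((h3 y (h ▸ hne)).trans h)⟩
    · have key : ∀ x, g x ≠ x → T₀.Adj x (g x) → F.Adj x (g x) := by
        intro x hgx hadj
        by_cases hpx : p x = x
        · exact absurd hadj (h4 x hpx hgx)
        · rw [h3 x hpx] at hadj ⊢
          exact (hT₀ x hpx).resolve_right (not_not_intro hadj)
      rw [Set.sdiff_eq_empty]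
      intro e
      induction e with
      | h x y =>
        rintro ⟨hxy, hadj⟩
        rw [SimpleGraph.mem_edgeSet] at hxy hadj ⊢
        obtain ⟨hne, rfl | rfl⟩ := parentGraph_adj.1 hxy
        · exact key x hne.symm hadj
        · exact (key y hne hadj.symm).symm
  · intro g hg g' hg' heq
    obtain ⟨h1, h2⟩ := Prod.mk.inj heq
    have hr' : g' (r g) = r g := by
      rw [← mem_roots, hr g' (mem_coe.1 hg'), mem_singleton]
      exact h2
    exact (mem_completions.1 (mem_coe.1 hg)).1.eq_of_parentGraph_eq (hr g (mem_coe.1 hg)) hr' h1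

lemma exists_initial_forest {n : ℕ} {T₀ F : SimpleGraph (Fin n)} (hF : F.IsAcyclic) {u v : Fin n}
    (huv : u ≠ v) (hT : ¬ T₀.Adj v u) :
    ∃ p : Fin n → Fin n, IsRootedForest p ∧ p v ≠ v ∧ n ≤ #(roots p) + F.edgeSet.ncard + 1 ∧
      (∀ x y, F.Adj x y → x ≠ y ∧ (p x = y ∨ p y = x)) ∧
      ∀ x, p x ≠ x → F.Adj x (p x) ∨ ¬ T₀.Adj x (p x) := by
  obtain ⟨p, hp, hpF, hFp, hpv⟩ := hF.exists_isRootedForest v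
  have hcard := card_nonroots_le hp hpF
  rw [Fintype.card_fin] at hcard
  by_cases hv : p v = v
  · have hiso : ∀ w, ¬ F.Adj v w := fun w hw => hpv w hw hv
    have hnev : ∀ x, x ≠ v → p x ≠ v := fun x hx h =>
      hiso x (h ▸ hpF x (by rw [h]; exact hx.symm)).symm
    -- Here `v` is isolated in `F`, so it can be hung below `u` at the cost of one root.
    refine ⟨Function.update p v u, ?_, by simpa using huv, ?_, fun x y hxy => ?_, fun x hx => ?_⟩
    · obtain ⟨h, hh⟩ := hp
      refine ⟨Function.update h v (h u + 1), fun x hx => ?_⟩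
      by_cases hxv : x = v
      · subst hxv
        simp [huv]
      · simp only [Function.update_of_ne hxv] at hx ⊢
        rw [Function.update_of_ne (hnev x hxv)]
        exact hh x hx
    · rw [roots_update huv, card_erase_of_mem (mem_roots.2 hv)]
      omega
    · have hxv : x ≠ v := by rintro rfl; exact hiso y hxy
      have hyv : y ≠ v := by rintro rfl; exact hiso x hxy.symm
      rw [Function.update_of_ne hxv, Function.update_of_ne hyv]
      exact ⟨hxy.ne, hFp x y hxy⟩
    · by_cases hxv : x = v
      · subst hxv
        simpa using Or.inr hT
      · rw [Function.update_of_ne hxv] at hx ⊢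
        exact Or.inl (hpF x hx)
  · exact ⟨p, hp, hv, by omega, fun x y h => ⟨h.ne, hFp x y h⟩, fun x hx => Or.inl (hpF x hx)⟩

theorem proposition3p1 (n t : ℕ) (hn : 2 * t + 110 ≤ n)
    (F : SimpleGraph (Fin n)) (hF : F.IsAcyclic) (hFt : F.edgeSet.ncard = t)
    (T₀ : SimpleGraph (Fin n)) (hT₀ : T₀ ∈ spanningTrees n \ stars n)
    (hTF : (T₀.edgeSet ∩ F.edgeSet).ncard < t) :
    n ^ (n - 2 * t - 17) < (treesAvoidingOutside T₀ F).ncard := by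
  classical
  have hT : T₀.IsTree := hT₀.1
  have : Nonempty (Fin n) := ⟨⟨0, by omega⟩⟩
  obtain ⟨v, -, hmax⟩ := exists_max_image univ (fun x => T₀.degree x) univ_nonempty
  obtain ⟨u, huv, hvu⟩ := exists_not_adj_of_notMem_stars hT hT₀.2 v
  obtain ⟨p, hp, hpv, hcard, hFp, hpT⟩ := exists_initial_forest hF huv hvu
  have hlt : #(roots p) ≤ n := (card_le_univ _).trans (by simp)
  have hsum : ∑ x, T₀.degree x ≤ 2 * Fintype.card (Fin n) := by
    rw [SimpleGraph.sum_degrees_eq_twice_card_edges]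
    have := hT.card_edgeFinset
    omega
  have hv : 1 ≤ T₀.degree v := by
    have : Nontrivial (Fin n) := ⟨u, v, huv⟩
    have := hT.connected.preconnected.degree_pos_of_nontrivial v
    omega
  -- By maximality of `v`, 3(deg a + deg b) ≤ 2(n + 3) < 3n.
  have hpair : ∀ a b, a ≠ b → a ≠ v → b ≠ v →
      T₀.degree a + T₀.degree b < Fintype.card (Fin n) := by
    intro a b hab hav hbv
    have h1 := hT.isAcyclic.degree_add_degree_add_degree_le hab hav hbv
    have h2 := hmax a (mem_univ a)
    have h3 := hmax b (mem_univ b)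
    rw [Fintype.card_fin] at h1 ⊢
    omega
  obtain ⟨j, hj⟩ : ∃ j, #(roots p) = j + 2 + 1 := ⟨#(roots p) - 3, by omega⟩
  have hmain := pow_mul_factorial_le_card_completions T₀ v hv hsum hpair (j + 2) p hp hpv hj
  have hle := card_completions_le hFp hpT
  rw [Fintype.card_fin, Nat.add_sub_cancel, Nat.factorial_succ, Nat.factorial_succ] at hmain
  set N := (treesAvoidingOutside T₀ F).ncard
  have hpos : 0 < n := by omega
  -- Two factors n absorb (j + 2)(j + 1); the third is the choice of root. Here j ≥ n - t - 4.
  have h1 : n ^ j ≤ n ^ 3 * N := by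
    refine Nat.le_of_mul_le_mul_right ?_ j.factorial_pos
    calc n ^ j * j.factorial ≤ (j + 2) * ((j + 1) * j.factorial) * #(completions T₀ p) := hmain
      _ ≤ n * (n * j.factorial) * (N * n) := by gcongr <;> omega
      _ = n ^ 3 * N * j.factorial := by ring
  have h2 : n ^ 3 * n ^ (n - 2 * t - 17) < n ^ 3 * N := by
    refine lt_of_lt_of_le ?_ h1
    rw [← pow_add]
    exact Nat.pow_lt_pow_right (by omega) (by omega)
  exact lt_of_mul_lt_mul_left h2 (Nat.zero_le _)
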